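/- Let $\mathbb K$ be an algebraically closed field of arbitrary characteristic, and let $X\subset W\subset\mathbb A^n_{\mathbb K}$ be affine varieties (possibly reducible). For a variety $Z$ let $I_Z\subset\mathbb K[x_1,\dots,x_n]$ be its vanishing ideal, $\mathbb K[Z]=\mathbb K[x_1,\dots,x_n]/I_Z$, and $I_{X,W}=I_X\,\mathbb K[W]$. For a polynomial $q$ let $D(q)=\{p\in\mathbb A^n_{\mathbb K}\mid q(p)\neq 0\}$. For a variety $Y\subset\mathbb A^n_{\mathbb K}$, call $Y\cap D(q)$ a smooth complete intersection of codimension $c$ in $D(q)$ if all local rings $\mathcal O_{Y,p}$, $p\in Y\cap D(q)$, are regular, $\dim (Y\cap D(q))=\dim D(q)-c$, and the ideal generated by $I_Y$ in $\mathcal O_{\mathbb A^n_{\mathbb K}}(D(q))=\mathbb K[x_1,\dots,x_n]_q$ can be generated by $c$ elements. Let $$\operatorname{Sing}(I_{X,W},2)=\{p\in X\mid \operatorname{ord}_p(I_{X,W})\ge 2\},$$ where $\operatorname{ord}_p(I_{X,W})$ is the largest $k$ with $I_{X,W}\mathcal O_{W,p}\subset\mathfrak m_{W,p}^k$ (and $\infty$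 if $I_{X,W}\mathcal O_{W,p}=0$). Suppose that $W$ is a smooth complete intersection of codimension $r$ in $\mathbb A^n_{\mathbb K}$ with $I_W=\langle f_1,\dots,f_r\rangle$, and let $f_{r+1},\dots,f_s\in\mathbb K[x_1,\dots,x_n]$ represent a set of generators of $I_{X,W}$. Let $M$ be an $r\times r$ submatrix of the Jacobian matrix $(\partial f_l/\partial x_j)$ of $f_1,\dots,f_r$, formed by columns $e_1,\dots,e_r$, let $h=\det M$, and let $A$ be the matrix of cofactors of $M$, so that $A\cdot M=h\cdot E_r$. Put $(\tilde f_1,\dots,\tilde f_r)^T=A\cdot(f_1,\dots,f_r)^T$ and, for $r+1\le i\le s$, $$\tilde f_i=h f_i-\sum_{k=1}^r\frac{\partial f_i}{\partial x_{e_k}}\tilde f_k .$$ For $r+1\le i\le s$ and $j\notin\{e_1,\dots,e_r\}$ let the relative derivative $\frac{\partial f_i}{\partial X_j}\in\mathbb K[x_1,\dots,x_n]$ be any polynomial with the same class as $\frac{\partial\tilde f_i}{\partial x_j}$ in $\mathcal O_W(W\cap D(h))/\langle f_i\rangle$. Suppose that $\operatorname{Sing}(I_{X,W},2)\cap D(h)=\emptyset$.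 Then $X\cap D(h)$ is covered by finitely many principal open sets of type $D(h\cdot g)\subset\mathbb A^n_{\mathbb K}$ such that, for each of them: 1. $g=\frac{\partial f_i}{\partial X_j}$ for some $i\in\{r+1,\dots,s\}$ and some $j\notin\{e_1,\dots,e_r\}$; 2. with $W'=V(f_1,\dots,f_r,f_i)\subset\mathbb A^n_{\mathbb K}$, the set $W'\cap D(h\cdot g)$ is a smooth complete intersection of codimension $r+1$ in $D(h\cdot g)$; 3. $X\cap D(h\cdot g)\subset W'\cap D(h\cdot g)$. -/

import Mathlib

open MvPolynomial

noncomputable section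

namespace MaxContact

variable {K : Type*} [Field K] {n : ℕ}

/-- An affine variety in affine `n`-space over `K` (possibly reducible, possibly empty): the set of
common zeros of an ideal of polynomials. -/
def IsAffineVariety (Z : Set (Fin n → K)) : Prop :=
  ∃ I : Ideal (MvPolynomial (Fin n) K), Z = zeroLocus K I

/-- The principal open set `D(h)` of affine `n`-space. -/
def principalOpen (h : MvPolynomial (Fin n) K) : Set (Fin n → K) :=
  {p | eval p h ≠ 0}

/-- The ring `K[Z]` of polynomial functions on `Z`. -/
abbrev CoordRing (Z : Set (Fin n → K)) : Type _ :=
  MvPolynomial (Fin n) K ⧸ vanishingIdeal K Z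

/-- The polynomial function on `Z` defined by a polynomial. -/
def toCoordRing (Z : Set (Fin n → K)) : MvPolynomial (Fin n) K →+* CoordRing Z :=
  Ideal.Quotient.mk (vanishingIdeal K Z)

/-- Evaluation of polynomial functions on `Z` at a point of `Z`. -/
def evalAt (Z : Set (Fin n → K)) (p : Z) : CoordRing Z →ₐ[K] K :=
  Ideal.Quotient.liftₐ (vanishingIdeal K Z) (aeval (p : Fin n → K)) (fun _ ha => ha p p.2)

/-- The maximal ideal of `K[Z]` of all polynomial functions that vanish at `p`. -/
def pointIdeal (Z : Set (Fin n → K)) (p : Z) : Ideal (CoordRing Z) :=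
  RingHom.ker (evalAt Z p)

instance (Z : Set (Fin n → K)) (p : Z) : (pointIdeal Z p).IsPrime :=
  RingHom.ker_isPrime (evalAt Z p)

/-- The local ring `𝒪_{Z,p}`. -/
abbrev LocalRingAt (Z : Set (Fin n → K)) (p : Z) : Type _ :=
  Localization.AtPrime (pointIdeal Z p)

/-- The ring `𝒪_Z(Z ∩ D(h))` of regular functions on `Z ∩ D(h)`: the localization of `K[Z]` at the
powers of the function defined by `h`. -/
abbrev SectionsOn (Z : Set (Fin n → K)) (h : MvPolynomial (Fin n) K) : Type _ :=
  Localization.Away (toCoordRing Z h)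

/-- The vanishing ideal `I_{X,W}` of `X` in `W`: the ideal of `K[W]` generated by `I_X`. -/
def relVanishingIdeal (X W : Set (Fin n → K)) : Ideal (CoordRing W) :=
  (vanishingIdeal K X).map (toCoordRing W)

/-- The order of an ideal `J` of a local ring: the largest `k` with `J ⊆ 𝔪 ^ k`
(it is `⊤` for the zero ideal). -/
def idealOrder {R : Type*} [CommRing R] [IsLocalRing R] (J : Ideal R) : ℕ∞ :=
  ⨆ (k : ℕ) (_ : J ≤ IsLocalRing.maximalIdeal R ^ k), (k : ℕ∞)

/-- The order at `p` of an ideal `I` of `K[W]`: the order of the extended ideal `I 𝒪_{W,p}`. -/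
def orderAt (W : Set (Fin n → K)) (p : W) (I : Ideal (CoordRing W)) : ℕ∞ :=
  idealOrder (I.map (algebraMap (CoordRing W) (LocalRingAt W p)))

/-- `Sing(I_{X,W}, b)`: the locus of points of `X` at which `I_{X,W}` has order at least `b`. -/
def orderLocus (X W : Set (Fin n → K)) (b : ℕ) : Set (Fin n → K) :=
  {p | p ∈ X ∧ ∃ hp : p ∈ W, (b : ℕ∞) ≤ orderAt W ⟨p, hp⟩ (relVanishingIdeal X W)}

/-- For a variety `Y`: the vanishing ideal of `Y ∩ D(q)` in `𝒪(D(q)) = K[x₁, …, xₙ]_q`, that is,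
the ideal generated by `I_Y`. -/
def idealOn (Y : Set (Fin n → K)) (q : MvPolynomial (Fin n) K) : Ideal (Localization.Away q) :=
  (vanishingIdeal K Y).map (algebraMap (MvPolynomial (Fin n) K) (Localization.Away q))

/-- For a variety `Y`: `Y ∩ D(q)` is a smooth complete intersection of codimension `c` in `D(q)`.
It is smooth at each of its points, `dim D(q) = dim (Y ∩ D(q)) + c`, and its vanishing ideal in
`𝒪(D(q))` can be generated by `c` elements. (The empty set has dimension `⊥`, so the equation of
dimensions forces `Y ∩ D(q)` to be non-empty as soon as `D(q)` is.) -/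
structure IsSmoothCompleteIntersectionOn
    (Y : Set (Fin n → K)) (q : MvPolynomial (Fin n) K) (c : ℕ) : Prop where
  smooth : ∀ p : Y, (p : Fin n → K) ∈ principalOpen q → IsRegularLocalRing (LocalRingAt Y p)
  codim : ringKrullDim (Localization.Away q) =
    ringKrullDim (Localization.Away q ⧸ idealOn Y q) + (c : WithBot ℕ∞)
  generated : ∃ g : Fin c → Localization.Away q, Ideal.span (Set.range g) = idealOn Y q

section RelativeDerivative

variable {r : ℕ} (F : Fin r → MvPolynomial (Fin n) K) (e : Fin r ↪ Fin n)

/-- The `r × r` submatrix `M` of the Jacobian matrix of `F` formed by the columns `e`. -/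
def jacobianSubmatrix : Matrix (Fin r) (Fin r) (MvPolynomial (Fin n) K) :=
  Matrix.of fun l k => pderiv (e k) (F l)

/-- The maximal minor `h = det M`. -/
def jacobianMinor : MvPolynomial (Fin n) K := (jacobianSubmatrix F e).det

/-- `(f̃₁, …, f̃ᵣ)ᵀ = A · (f₁, …, fᵣ)ᵀ`, where `A` is the matrix of cofactors of `M`, so that
`A · M = h · Eᵣ`. -/
def tildeSystem : Fin r → MvPolynomial (Fin n) K :=
  (jacobianSubmatrix F e).adjugate.mulVec F

/-- `f̃ = h f - ∑ₖ (∂f/∂x_{e k}) f̃ₖ`: the row operations, applied to `h f`, that clear the columns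
`e` of its row of partial derivatives modulo `f₁, …, fᵣ, f`. -/
def tildePoly (f : MvPolynomial (Fin n) K) : MvPolynomial (Fin n) K :=
  jacobianMinor F e * f - ∑ k, pderiv (e k) f * tildeSystem F e k

/-- The polynomial `g` is a representative of the relative derivative `∂f/∂X_j`: the classes of `g`
and of the partial derivative `∂f̃/∂x_j` in `𝒪_W(W ∩ D(h)) / ⟨f⟩` are equal. -/
def IsRelativeDerivative (W : Set (Fin n → K)) (f : MvPolynomial (Fin n) K) (j : Fin n)
    (g : MvPolynomial (Fin n) K) : Prop :=
  algebraMap (CoordRing W) (SectionsOn W (jacobianMinor F e))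
      (toCoordRing W (g - pderiv j (tildePoly F e f))) ∈
    Ideal.span {algebraMap (CoordRing W) (SectionsOn W (jacobianMinor F e)) (toCoordRing W f)}

end RelativeDerivative

end MaxContact

end

/-! At a point `p` of `W ∩ D(h)` the matrix `M` is invertible, so the gradients of `F` are
independent there. Modulo `I_W` the polynomial `f̃` is `h f`, and at zeros of `F` and `f` its
gradient vanishes in the columns `e`. Covering: if all other partial derivatives of every `f̃_i`
also vanished at a point `p` of `X ∩ D(h)`, Taylor's formula would put every `f̃_i`, hence every
`f_i`, into `𝔪_{W,p}²`, so `I_{X,W}` would have order at least 2 at `p`, which `hSing` excludes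
(`exists_pderiv_tildePoly_ne_zero`). A relative derivative has the same value at `p` as `∂f̃_i/∂x_j`
(`IsRelativeDerivative.eval_eq`). Smoothness: at a point of `W' ∩ D(hg)`, a gradient of `f_i` in the
span of the gradients of `F` would put that of `f̃_i` there too; its zeros in the columns `e` would
then force it to be 0, against `g ≠ 0`. So the `r + 1` gradients are independent
(`linearIndependent_gradientAt_snoc`), and the Jacobian criterion
(`isSmoothCompleteIntersectionOn_of_linearIndependent`) applies. It rests on regular local rings
being domains: this makes `⟨F, f_i⟩` radical on `D(hg)`, hence equal there to the vanishing ideal of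
`W'`. -/

/-! ### Regular local rings: cutting by a parameter, and integrality. -/

open IsLocalRing in
/-- The quotient of a regular local ring by an element of `𝔪 \ 𝔪²` is a regular local ring of
dimension one less. -/
theorem IsRegularLocalRing.quotient_span_singleton {R : Type*} [CommRing R] [IsRegularLocalRing R]
    {x : R} (hx : x ∈ maximalIdeal R) (hx2 : x ∉ maximalIdeal R ^ 2) :
    IsRegularLocalRing (R ⧸ Ideal.span {x}) ∧
      ringKrullDim (R ⧸ Ideal.span {x}) + 1 = ringKrullDim R := by
  classical
  have hle : Ideal.span {x} ≤ maximalIdeal R := by simpa [Ideal.span_le] using hx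
  have : Nontrivial (R ⧸ Ideal.span {x}) :=
    Ideal.Quotient.nontrivial_iff.2 fun h => Ideal.IsPrime.ne_top' (top_le_iff.1 (h ▸ hle))
  have : IsLocalRing (R ⧸ Ideal.span {x}) :=
    IsLocalRing.of_surjective' (Ideal.Quotient.mk _) Ideal.Quotient.mk_surjective
  -- The class of `x` is extended to a basis of `𝔪/𝔪²`. By Nakayama its lifts generate `𝔪`, so
  -- `𝔪/(x)` needs one generator fewer; since the dimension drops by at most one, equality is
  -- forced.
  let v : CotangentSpace R := (maximalIdeal R).toCotangent ⟨x, hx⟩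
  have hv : v ≠ 0 := fun h => hx2 ((Ideal.toCotangent_eq_zero _ _).1 h)
  have hli : LinearIndepOn (ResidueField R) id {v} := (linearIndepOn_singleton_iff _).2 hv
  set b := hli.extend (Set.subset_univ {v})
  have hvb : v ∈ b := hli.subset_extend _ rfl
  have hbli : LinearIndepOn (ResidueField R) id b := hli.linearIndepOn_extend _
  have hspan : Submodule.span (ResidueField R) b = ⊤ := by
    have := hli.span_extend_eq_span (Set.subset_univ {v})
    simpa using this
  have hbfin : b.Finite := LinearIndependent.setFinite hbli
  have hbcard : b.ncard = Module.finrank (ResidueField R) (CotangentSpace R) := by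
    have := hbfin.fintype
    rw [Set.ncard_eq_toFinset_card', ← finrank_span_set_eq_card hbli, hspan, finrank_top]
  obtain ⟨σ, hσ⟩ := (maximalIdeal R).toCotangent_surjective.hasRightInverse
  let t : Set (maximalIdeal R) := insert ⟨x, hx⟩ (σ '' (b \ {v}))
  have ht : Submodule.span R t = ⊤ := by
    rw [← CotangentSpace.span_image_eq_top_iff, ← hspan]
    congr 1
    rw [Set.image_insert_eq, ← Set.image_comp]
    have : ((maximalIdeal R).toCotangent ∘ σ) = id := funext hσ
    rw [this, Set.image_id]
    exact Set.insert_sdiff_self_of_mem hvb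
  have ht' : Ideal.span (insert x ((fun y => (σ y : R)) '' (b \ {v}))) = maximalIdeal R := by
    have := congrArg (Submodule.map (maximalIdeal R).subtype) ht
    rw [Submodule.map_span, Submodule.map_top, Submodule.range_subtype] at this
    rwa [Set.image_insert_eq, ← Set.image_comp] at this
  have hmax : maximalIdeal (R ⧸ Ideal.span {x}) =
      Ideal.span ((fun y => Ideal.Quotient.mk (Ideal.span {x}) (σ y : R)) '' (b \ {v})) := by
    have := congrArg (Ideal.map (Ideal.Quotient.mk (Ideal.span {x}))) ht'
    rw [IsLocalRing.map_maximalIdeal_of_surjective (Ideal.Quotient.mk (Ideal.span {x}))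
      Ideal.Quotient.mk_surjective, Ideal.map_span, Set.image_insert_eq, ← Set.image_comp,
      Ideal.Quotient.eq_zero_iff_mem.2 (Ideal.mem_span_singleton_self x),
      Ideal.span_insert_zero] at this
    exact this.symm
  have hrank : (maximalIdeal (R ⧸ Ideal.span {x})).spanFinrank + 1 ≤
      Module.finrank (ResidueField R) (CotangentSpace R) := by
    rw [← hbcard, ← Set.ncard_sdiff_singleton_add_one hvb hbfin, hmax]
    gcongr
    exact (Submodule.spanFinrank_span_le_ncard_of_finite ((hbfin.sdiff).image _)).trans
      (Set.ncard_image_le hbfin.sdiff)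
  have hdim : ringKrullDim R ≤ ringKrullDim (R ⧸ Ideal.span {x}) + 1 := by
    rw [← IsLocalRing.maximalIdeal_height_eq_ringKrullDim (R := R)]
    exact Ideal.height_le_ringKrullDim_quotient_add_one hx
  rw [← (IsRegularLocalRing.iff_finrank_cotangentSpace R).1 inferInstance] at hdim ⊢
  have h1 : ringKrullDim (R ⧸ Ideal.span {x}) ≤ _ := ringKrullDim_le_spanFinrank_maximalIdeal _
  have h2 : (((maximalIdeal (R ⧸ Ideal.span {x})).spanFinrank : ℕ) : WithBot ℕ∞) + 1 ≤
      (Module.finrank (ResidueField R) (CotangentSpace R) : ℕ) := by exact_mod_cast hrank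
  have h3 : ringKrullDim (R ⧸ Ideal.span {x}) + 1 ≤
      (Module.finrank (ResidueField R) (CotangentSpace R) : ℕ) := le_trans (by gcongr) h2
  refine ⟨.of_spanFinrank_maximalIdeal_le _ ?_, le_antisymm h3 hdim⟩
  have h4 := h2.trans hdim
  exact ENat.WithBot.add_le_add_one_right_iff.1 h4

open IsLocalRing in
/-- A Noetherian local ring is a domain if a principal ideal that is not contained in
a minimal prime is prime. -/
theorem IsLocalRing.isDomain_of_isDomain_quotient {R : Type*} [CommRing R] [IsLocalRing R]
    [IsNoetherianRing R] {x : R} (hx : x ∈ maximalIdeal R) (hx' : ∀ P ∈ minimalPrimes R, x ∉ P)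
    [IsDomain (R ⧸ Ideal.span {x})] : IsDomain R := by
  have hp : (Ideal.span {x}).IsPrime := Ideal.Quotient.isDomain_iff_prime _ |>.1 inferInstance
  obtain ⟨P, hP, hPx⟩ := Ideal.exists_minimalPrimes_le (I := ⊥) (J := Ideal.span {x}) bot_le
  have hPp : P.IsPrime := hP.1.1
  have hxP := hx' P hP
  -- If `y = a x` lies in `P`, then `a ∈ P` because `x ∉ P`. Hence `P = 𝔪 P`, and Nakayama gives `P
  -- = 0`.
  have hPbot : P = ⊥ := by
    refine Submodule.eq_bot_of_le_smul_of_le_jacobson_bot (maximalIdeal R) P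
      (IsNoetherian.noetherian P) ?_ (maximalIdeal_le_jacobson _)
    intro y hy
    obtain ⟨a, rfl⟩ := Ideal.mem_span_singleton'.1 (hPx hy)
    rw [mul_comm]
    exact Submodule.smul_mem_smul hx ((hPp.mem_or_mem hy).resolve_right hxP)
  subst hPbot
  exact IsDomain.of_bot_isPrime R

open IsLocalRing in
/-- A regular local ring is a domain. -/
theorem IsRegularLocalRing.isDomain (R : Type*) [CommRing R] [IsRegularLocalRing R] :
    IsDomain R := by
  classical
  obtain ⟨d, hd⟩ : ∃ d : ℕ, ringKrullDim R = d :=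
    ⟨_, (IsRegularLocalRing.spanFinrank_maximalIdeal (R := R)).symm⟩
  induction d generalizing R with
  | zero =>
    have h0 := (IsRegularLocalRing.spanFinrank_maximalIdeal (R := R)).trans hd
    have h1 : maximalIdeal R = ⊥ :=
      (Submodule.spanFinrank_eq_zero_iff_eq_bot (IsNoetherian.noetherian _)).1
        (by exact_mod_cast h0)
    exact (IsLocalRing.isField_iff_maximalIdeal_eq.2 h1).isDomain
  | succ d ih =>
    have hht : (maximalIdeal R).height = (d + 1 : ℕ) := by
      have := IsLocalRing.maximalIdeal_height_eq_ringKrullDim (R := R)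
      rw [hd] at this
      exact_mod_cast this
    obtain ⟨x, hx, hxn⟩ : ∃ x ∈ maximalIdeal R, x ∉ maximalIdeal R ^ 2 ∧
        ∀ P ∈ minimalPrimes R, x ∉ P := by
      -- Prime avoidance, which tolerates the non-prime member `𝔪²`. If `𝔪` lay in `𝔪²` (so `𝔪 = 0`
      -- by Nakayama) or in a minimal prime, its height would be 0 instead of `d + 1`.
      by_contra! hcon
      let T : Finset (Ideal R) :=
        insert (maximalIdeal R ^ 2) (minimalPrimes.finite_of_isNoetherianRing R).toFinset
      have hsub : ((maximalIdeal R : Ideal R) : Set R) ⊆ ⋃ P ∈ (T : Set (Ideal R)), (P : Set R) := by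
        intro x hx
        by_cases h2 : x ∈ maximalIdeal R ^ 2
        · exact Set.mem_biUnion (by simp [T]) h2
        · obtain ⟨P, hP, hxP⟩ := hcon x hx h2
          exact Set.mem_biUnion (by simp [T, hP]) hxP
      obtain ⟨P, hPT, hP⟩ := (Ideal.subset_union_prime (f := id) (maximalIdeal R ^ 2)
        (maximalIdeal R ^ 2) (fun P hP hne _ => by
          rcases Finset.mem_insert.1 hP with h | h
          · exact absurd h hne
          · exact (by simpa using h : P ∈ minimalPrimes R).1.1)).1 hsub
      rcases Finset.mem_insert.1 hPT with h | h
      · have hbot : maximalIdeal R = ⊥ := by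
          refine Submodule.eq_bot_of_le_smul_of_le_jacobson_bot (maximalIdeal R) _
            (IsNoetherian.noetherian _) ?_ (maximalIdeal_le_jacobson _)
          rw [h, id, pow_two] at hP
          exact hP
        have : (maximalIdeal R).height ≤ 0 := by
          refine (Ideal.height_le_spanFinrank (maximalIdeal R) Ideal.IsPrime.ne_top').trans ?_
          rw [hbot]
          simp
        rw [hht] at this
        simp at this
      · have hmin : P ∈ minimalPrimes R := by simpa using h
        have hPp : P.IsPrime := hmin.1.1
        have := Ideal.height_mono hP
        rw [id, Ideal.height_eq_zero_iff.2 hmin, hht] at this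
        simp at this
    obtain ⟨hreg, hdim⟩ := IsRegularLocalRing.quotient_span_singleton hx hxn.1
    have hdim' : ringKrullDim (R ⧸ Ideal.span {x}) = d := by
      rw [hd, Nat.cast_add, Nat.cast_one] at hdim
      exact ENat.WithBot.add_one_cancel.1 hdim
    have := ih (R ⧸ Ideal.span {x}) hdim'
    exact IsLocalRing.isDomain_of_isDomain_quotient hx hxn.2

/-! ### Regularity, reducedness and heights from local generators. -/

open IsLocalRing in
/-- Let `N` be a prime of `A ⧸ I` whose preimage `M` has height `m + c`, where `I` has `c`
generators. If `M` is generated near `M` by `I` and `m` elements, then the local ring of `A ⧸ I`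
at `N` is regular. -/
theorem IsRegularLocalRing.of_isLocalization_quotient {A : Type*} [CommRing A] [IsNoetherianRing A]
    {I : Ideal A} {c m : ℕ} (hI : I.spanFinrank ≤ c) (N : Ideal (A ⧸ I)) [N.IsPrime]
    (hN : (N.comap (Ideal.Quotient.mk I)).height = (m + c : ℕ)) (w : Fin m → A)
    (hwN : ∀ k, w k ∈ N.comap (Ideal.Quotient.mk I)) {s : A}
    (hs : s ∉ N.comap (Ideal.Quotient.mk I))
    (hw : ∀ a ∈ N.comap (Ideal.Quotient.mk I), s * a ∈ I ⊔ Ideal.span (Set.range w))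
    (L : Type*) [CommRing L] [Algebra (A ⧸ I) L] [IsLocalization.AtPrime L N] :
    IsRegularLocalRing L := by
  have : IsLocalRing L := IsLocalization.AtPrime.isLocalRing L N
  have : IsNoetherianRing L := IsLocalization.isNoetherianRing N.primeCompl L inferInstance
  let ψ : A →+* L := (algebraMap (A ⧸ I) L).comp (Ideal.Quotient.mk I)
  -- In `L` the ideal `I` dies and `s` becomes a unit, so only the images of `w` remain as
  -- generators.
  have hmax : maximalIdeal L ≤ Ideal.span (Set.range (ψ ∘ w)) := by
    rw [← IsLocalization.AtPrime.map_eq_maximalIdeal N L, Ideal.map_le_iff_le_comap]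
    intro b hb
    obtain ⟨a, rfl⟩ := Ideal.Quotient.mk_surjective b
    have h1 : ψ (s * a) ∈ Ideal.span (Set.range (ψ ∘ w)) := by
      have := Ideal.mem_map_of_mem ψ (hw a hb)
      rw [Ideal.map_sup, Ideal.map_span, ← Set.range_comp] at this
      have hI0 : I.map ψ = ⊥ := by
        rw [← Ideal.map_map, Ideal.map_quotient_self, Ideal.map_bot]
      rwa [hI0, bot_sup_eq] at this
    rw [map_mul] at h1
    exact (Ideal.unit_mul_mem_iff_mem _
      (IsLocalization.map_units L (⟨Ideal.Quotient.mk I s, hs⟩ : N.primeCompl))).1 h1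
  have hmax' : Ideal.span (Set.range (ψ ∘ w)) = maximalIdeal L := by
    refine le_antisymm ?_ hmax
    rw [Ideal.span_le, ← IsLocalization.AtPrime.map_eq_maximalIdeal N L]
    rintro _ ⟨k, rfl⟩
    exact Ideal.mem_map_of_mem _ (hwN k)
  -- Dividing by `I` lowers the height `m + c` by at most the number of generators, `c`.
  have hge : (m : ℕ∞) ≤ N.height := by
    have h := Ideal.height_le_height_add_spanFinrank_of_le
      (I := I) (p := N.comap (Ideal.Quotient.mk I))
      (fun a ha => by
        rw [Ideal.mem_comap, Ideal.Quotient.eq_zero_iff_mem.2 ha]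
        exact N.zero_mem)
    rw [Ideal.map_comap_of_surjective _ Ideal.Quotient.mk_surjective, hN, Nat.cast_add] at h
    have h2 : (m : ℕ∞) + c ≤ N.height + c := h.trans (by gcongr)
    exact (ENat.add_le_add_iff_right (ENat.natCast_ne_top c)).1 h2
  apply IsRegularLocalRing.of_spanFinrank_maximalIdeal_le
  rw [IsLocalization.AtPrime.ringKrullDim_eq_height N L]
  refine le_trans ?_ (WithBot.coe_le_coe.2 hge)
  have hrank : (maximalIdeal L).spanFinrank ≤ m := by
    rw [← hmax']
    refine (Submodule.spanFinrank_span_le_ncard_of_finite (Set.finite_range _)).trans ?_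
    rw [← Nat.card_coe_set_eq]
    exact (Finite.card_range_le _).trans_eq (Nat.card_fin m)
  exact_mod_cast hrank

/-- If every element of `J ⊇ I` is locally at a prime `P` of `A ⧸ J` in `I`, then the local ring
of `A ⧸ J` at `P` is also a local ring of `A ⧸ I`. -/
theorem IsLocalization.AtPrime.of_quotient_factor {A : Type*} [CommRing A] {I J : Ideal A}
    (hIJ : I ≤ J) (P : Ideal (A ⧸ J)) [P.IsPrime]
    (hJ : ∀ a ∈ J, ∃ s ∉ P.comap (Ideal.Quotient.mk J), s * a ∈ I)
    (L : Type*) [CommRing L] [Algebra (A ⧸ J) L] [IsLocalization.AtPrime L P] :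
    letI := ((algebraMap (A ⧸ J) L).comp (Ideal.Quotient.factor hIJ)).toAlgebra
    IsLocalization.AtPrime L (P.comap (Ideal.Quotient.factor hIJ)) := by
  let := ((algebraMap (A ⧸ J) L).comp (Ideal.Quotient.factor hIJ)).toAlgebra
  have halg : ∀ a : A, algebraMap (A ⧸ I) L (Ideal.Quotient.mk I a) =
      algebraMap (A ⧸ J) L (Ideal.Quotient.mk J a) := fun a => rfl
  refine ⟨?_, ?_, ?_⟩
  · rintro ⟨y, hy⟩
    exact IsLocalization.map_units L (⟨Ideal.Quotient.factor hIJ y, hy⟩ : P.primeCompl)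
  · intro z
    obtain ⟨⟨x, y⟩, hxy⟩ := IsLocalization.surj P.primeCompl z
    obtain ⟨a, rfl⟩ := Ideal.Quotient.mk_surjective x
    obtain ⟨y, hy⟩ := y
    obtain ⟨b, rfl⟩ := Ideal.Quotient.mk_surjective y
    exact ⟨(Ideal.Quotient.mk I a, ⟨Ideal.Quotient.mk I b, hy⟩), hxy⟩
  · intro x y hxy
    obtain ⟨a, rfl⟩ := Ideal.Quotient.mk_surjective x
    obtain ⟨b, rfl⟩ := Ideal.Quotient.mk_surjective y
    rw [halg, halg] at hxy
    obtain ⟨⟨t, ht⟩, hc⟩ := IsLocalization.exists_of_eq (M := P.primeCompl) hxy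
    obtain ⟨t, rfl⟩ := Ideal.Quotient.mk_surjective t
    simp only [← map_mul] at hc
    obtain ⟨s, hs, hsI⟩ := hJ _ (Ideal.Quotient.eq.1 hc)
    refine ⟨⟨Ideal.Quotient.mk I (s * t), ?_⟩, ?_⟩
    · intro hmem
      rw [SetLike.mem_coe, Ideal.mem_comap, Ideal.Quotient.factor_mk, map_mul] at hmem
      exact (Ideal.IsPrime.mem_or_mem ‹_› hmem).elim hs ht
    · simp only [← map_mul]
      rw [Ideal.Quotient.eq]
      convert hsI using 1
      ring

/-- If the local ring of `A ⧸ I` at `N` is regular, then every element of the radical of `I`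
is locally at `N` in `I`. -/
theorem Ideal.exists_mul_mem_of_mem_radical {A : Type*} [CommRing A] {I : Ideal A}
    (N : Ideal (A ⧸ I)) [N.IsPrime] [IsReduced (Localization.AtPrime N)] {a : A}
    (ha : a ∈ I.radical) : ∃ s ∉ N.comap (Ideal.Quotient.mk I), s * a ∈ I := by
  obtain ⟨k, hk⟩ := ha
  have hnil : algebraMap (A ⧸ I) (Localization.AtPrime N) (Ideal.Quotient.mk I a) = 0 := by
    apply IsReduced.eq_zero
    refine ⟨k, ?_⟩
    rw [← map_pow, ← map_pow, Ideal.Quotient.eq_zero_iff_mem.2 hk, map_zero]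
  obtain ⟨⟨t, ht⟩, hc⟩ := (IsLocalization.map_eq_zero_iff N.primeCompl _ _).1 hnil
  obtain ⟨t, rfl⟩ := Ideal.Quotient.mk_surjective t
  exact ⟨t, ht, by simpa [← map_mul, Ideal.Quotient.eq_zero_iff_mem] using hc⟩

/-- Let `φ : A → B` be such that every prime of `B` is generated by its preimage. If the preimage
`M` of the prime `N` of `B` is mapped near `N` into the ideal generated by `m` elements of the
image of `M`, then `N` has height at most `m`. -/
theorem Ideal.height_le_of_forall_mul_mem_span {A B : Type*} [CommRing A] [CommRing B]
    [IsNoetherianRing B] (φ : A →+* B) (N : Ideal B) [N.IsPrime]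
    (hφ : N ≤ (N.comap φ).map φ) {m : ℕ} (w : Fin m → A)
    (hwN : ∀ k, w k ∈ N.comap φ) {s : A} (hs : s ∉ N.comap φ)
    (hw : ∀ a ∈ N.comap φ, φ (s * a) ∈ Ideal.span (Set.range (φ ∘ w))) :
    N.height ≤ m := by
  -- Krull's height theorem applies once `N` is minimal over the `w`: a prime `Q ⊆ N` containing
  -- them cannot contain the image of `s`, so it contains the image of the preimage of `N`.
  have hmin : N ∈ (Ideal.span (Set.range (φ ∘ w))).minimalPrimes := by
    refine ⟨⟨inferInstance, ?_⟩, ?_⟩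
    · rw [Ideal.span_le]
      rintro _ ⟨k, rfl⟩
      exact hwN k
    · rintro Q ⟨hQ, hwQ⟩ hQN
      refine hφ.trans (Ideal.map_le_iff_le_comap.2 fun a ha => ?_)
      have h := hwQ (hw a ha)
      rw [map_mul] at h
      exact (hQ.mem_or_mem h).resolve_left fun h => hs (hQN h)
  refine (Ideal.height_le_card_of_mem_minimalPrimes_span (Set.finite_range _) hmin).trans ?_
  have := Finite.card_range_le (φ ∘ w)
  rw [Nat.card_fin, Nat.card_coe_set_eq] at this
  exact_mod_cast this

/-! ### Gradients, Taylor's formula and the height of closed points. -/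

namespace MvPolynomial

variable {K σ : Type*} [Field K]

theorem mem_vanishingIdeal_singleton {p : σ → K} {f : MvPolynomial σ K} :
    f ∈ vanishingIdeal K {p} ↔ eval p f = 0 := by
  rw [mem_vanishingIdeal_singleton_iff, aeval_eq_eval]

/-- The gradient of a polynomial at a point. -/
noncomputable def gradientAt (p : σ → K) : MvPolynomial σ K →ₗ[K] (σ → K) where
  toFun f i := eval p (pderiv i f)
  map_add' f g := by ext i; simp
  map_smul' a f := by ext i; simp [smul_eval]

theorem gradientAt_apply (p : σ → K) (f : MvPolynomial σ K) (i : σ) :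
    gradientAt p f i = eval p (pderiv i f) := rfl

theorem gradientAt_mul (p : σ → K) (f g : MvPolynomial σ K) :
    gradientAt p (f * g) = eval p f • gradientAt p g + eval p g • gradientAt p f := by
  ext i
  simp only [gradientAt_apply, pderiv_mul, map_add, map_mul, Pi.add_apply, Pi.smul_apply,
    smul_eq_mul]
  ring

variable [Fintype σ]

/-- The polynomial of degree one that vanishes at `p` and has a given gradient. -/
noncomputable def linearFormAt (p : σ → K) : (σ → K) →ₗ[K] MvPolynomial σ K where
  toFun v := ∑ i, C (v i) * (X i - C (p i))
  map_add' v w := by simp [add_mul, Finset.sum_add_distrib]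
  map_smul' a v := by simp [Finset.smul_sum, smul_eq_C_mul, mul_assoc]

theorem linearFormAt_apply (p v : σ → K) :
    linearFormAt p v = ∑ i, C (v i) * (X i - C (p i)) := rfl

theorem eval_linearFormAt (p v : σ → K) : eval p (linearFormAt p v) = 0 := by
  simp [linearFormAt_apply]

theorem linearFormAt_single [DecidableEq σ] (p : σ → K) (i : σ) :
    linearFormAt p (Pi.single i 1) = X i - C (p i) := by
  rw [linearFormAt_apply, Finset.sum_eq_single i (fun j _ hj => by simp [hj]) (by simp)]
  simp

/-- The first order Taylor formula. -/
theorem sub_sub_linearFormAt_mem (p : σ → K) (f : MvPolynomial σ K) :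
    f - C (eval p f) - linearFormAt p (gradientAt p f) ∈ vanishingIdeal K {p} ^ 2 := by
  classical
  induction f using MvPolynomial.induction_on with
  | C a =>
    have : gradientAt p (C a) = 0 := by ext i; simp [gradientAt_apply]
    simp [this]
  | add f g hf hg =>
    convert add_mem hf hg using 1
    simp only [map_add]
    ring
  | mul_X f j hf =>
    have hX : gradientAt p (X j) = Pi.single j 1 := by
      ext i
      by_cases h : i = j
      · subst h; simp [gradientAt_apply]
      · simp [gradientAt_apply, pderiv_X_of_ne (Ne.symm h), h]
    -- The new error term in the product rule: a product of two polynomials vanishing at `p`.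
    have h1 : (linearFormAt p (gradientAt p f)) * (X j - C (p j)) ∈ vanishingIdeal K {p} ^ 2 := by
      rw [pow_two]
      exact Ideal.mul_mem_mul (mem_vanishingIdeal_singleton.2 (eval_linearFormAt p _))
        (mem_vanishingIdeal_singleton.2 (by simp))
    convert add_mem (Ideal.mul_mem_right (X j) _ hf) h1 using 1
    rw [gradientAt_mul, hX, map_add, map_smul, map_smul, linearFormAt_single, smul_eq_C_mul,
      smul_eq_C_mul, eval_X, map_mul, eval_X, map_mul]
    ring

/-- If the gradients of the polynomials `u` at `p` are linearly independent, then near `p` the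
maximal ideal of `p` is generated by `u` and `n - c` further polynomials. -/
theorem exists_local_generators {ι : Type*} [Fintype ι] (p : σ → K) (u : ι → MvPolynomial σ K)
    (hu : ∀ k, eval p (u k) = 0) (hli : LinearIndependent K fun k => gradientAt p (u k)) :
    ∃ (m : ℕ) (_ : m + Fintype.card ι = Fintype.card σ) (w : Fin m → MvPolynomial σ K)
      (s : MvPolynomial σ K), (∀ k, eval p (w k) = 0) ∧ eval p s ≠ 0 ∧
      ∀ a, eval p a = 0 → s * a ∈ Ideal.span (Set.range u) ⊔ Ideal.span (Set.range w) := by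
  set W := Submodule.span K (Set.range fun k => gradientAt p (u k)) with hW
  obtain ⟨W', hc⟩ := exists_isCompl W
  let b := Module.finBasis K W'
  let w : Fin (Module.finrank K W') → MvPolynomial σ K := fun k => linearFormAt p (b k)
  have hw : ∀ k, eval p (w k) = 0 := fun k => eval_linearFormAt p _
  set J := Ideal.span (Set.range u) ⊔ Ideal.span (Set.range w) with hJ
  set M := vanishingIdeal K {p} with hM
  -- Linear forms with gradient in `W` are combinations of the `u` modulo `M²`; those with gradient
  -- in the complement `W'` are combinations of the `w`.
  have hlin : ∀ v, linearFormAt p v ∈ J ⊔ M ^ 2 := by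
    have htop : W ⊔ W' ≤ ((J ⊔ M ^ 2).restrictScalars K).comap (linearFormAt p) := by
      refine sup_le ?_ ?_
      · rw [hW, Submodule.span_le]
        rintro _ ⟨k, rfl⟩
        have h := sub_sub_linearFormAt_mem p (u k)
        rw [hu k, map_zero, sub_zero] at h
        have h2 : u k ∈ J := Ideal.mem_sup_left (Ideal.subset_span ⟨k, rfl⟩)
        have h3 := sub_mem (Ideal.mem_sup_left (T := M ^ 2) h2) (Ideal.mem_sup_right (S := J) h)
        rw [sub_sub_cancel] at h3
        exact h3
      · have : Submodule.map W'.subtype (Submodule.span K (Set.range b)) = W' := by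
          rw [b.span_eq, Submodule.map_top, Submodule.range_subtype]
        rw [← this, Submodule.map_span, Submodule.span_le]
        rintro _ ⟨_, ⟨k, rfl⟩, rfl⟩
        exact Ideal.mem_sup_left (Ideal.mem_sup_right (Ideal.subset_span ⟨k, rfl⟩))
    rw [hc.sup_eq_top] at htop
    exact fun v => htop trivial
  have hle : M ≤ J ⊔ M • M := by
    intro f hf
    have h := sub_sub_linearFormAt_mem p f
    rw [mem_vanishingIdeal_singleton.1 hf, map_zero, sub_zero] at h
    have := add_mem (Ideal.mem_sup_right (S := J) h) (hlin (gradientAt p f))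
    simpa [pow_two] using this
  -- Nakayama without localizing: `M ≤ J + M²` yields `s ≡ 1` modulo `M` with `s M ≤ J`.
  obtain ⟨s, hs, hsM⟩ := Submodule.exists_sub_one_mem_and_smul_le_of_fg_of_le_sup
    (I := M) (N := J) (N' := M) (IsNoetherian.noetherian M) le_rfl hle
  refine ⟨_, ?_, w, s, hw, ?_, fun a ha => ?_⟩
  · rw [← finrank_span_eq_card hli, add_comm, Submodule.finrank_add_eq_of_isCompl hc,
      Module.finrank_fintype_fun_eq_card]
  · have := mem_vanishingIdeal_singleton.1 hs
    rw [map_sub, map_one, sub_eq_zero] at this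
    rw [this]
    exact one_ne_zero
  · exact hsM (Submodule.smul_mem_pointwise_smul _ _ _ (mem_vanishingIdeal_singleton.2 ha))

/-- All closed points of affine `n`-space over an algebraically closed field have height `n`. -/
theorem height_vanishingIdeal_singleton [IsAlgClosed K] (p : σ → K) :
    (vanishingIdeal K {p}).height = Fintype.card σ := by
  have hdim : ringKrullDim (MvPolynomial σ K) = Fintype.card σ := by
    rw [MvPolynomial.ringKrullDim_of_isNoetherianRing, ringKrullDim_eq_zero_of_field, zero_add,
      Nat.card_eq_fintype_card]
  have : FiniteRingKrullDim (MvPolynomial σ K) := by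
    rw [finiteRingKrullDim_iff_ne_bot_and_top, hdim]
    exact ⟨by simp, fun h => ENat.natCast_ne_top _ (WithBot.coe_injective h)⟩
  -- Some maximal ideal has height equal to the Krull dimension; by the Nullstellensatz it belongs
  -- to a point `y`, and a translation carries it to `p`.
  obtain ⟨N, hN, hht⟩ := Ideal.exists_isMaximal_height (R := MvPolynomial σ K)
  obtain ⟨y, rfl⟩ := isMaximal_iff_eq_vanishingIdeal_singleton.1 hN
  let φ (v : σ → K) : MvPolynomial σ K →ₐ[K] MvPolynomial σ K := aeval fun i => X i + C (v i)
  have hφ (v : σ → K) : (φ v).comp (φ (-v)) = AlgHom.id K _ := by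
    ext i : 1
    simp [φ]
  let e : MvPolynomial σ K ≃ₐ[K] MvPolynomial σ K := AlgEquiv.ofAlgHom (φ (y - p)) (φ (-(y - p)))
    (hφ _) (by simpa using hφ (-(y - p)))
  have he : (vanishingIdeal K {p}).comap (e : MvPolynomial σ K ≃+* MvPolynomial σ K) =
      vanishingIdeal K {y} := by
    ext f
    rw [Ideal.mem_comap, mem_vanishingIdeal_singleton, mem_vanishingIdeal_singleton]
    have : (aeval p : MvPolynomial σ K →ₐ[K] K).comp (φ (y - p)) = aeval y := by
      ext i
      simp [φ]
    have := DFunLike.congr_fun this f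
    simp only [AlgHom.comp_apply, aeval_eq_eval] at this
    rw [← this]
    rfl
  have h := (e : MvPolynomial σ K ≃+* MvPolynomial σ K).height_comap (vanishingIdeal K {p})
  rw [he] at h
  rw [hdim, h] at hht
  exact_mod_cast hht

end MvPolynomial

/-! ### The Jacobian criterion on a principal open set. -/

namespace MaxContact

variable {K : Type*} [Field K] {n : ℕ}

theorem comap_pointIdeal (Z : Set (Fin n → K)) (p : Z) :
    (pointIdeal Z p).comap (Ideal.Quotient.mk (vanishingIdeal K Z)) =
      vanishingIdeal K {(p : Fin n → K)} := by
  ext f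
  rw [Ideal.mem_comap, mem_vanishingIdeal_singleton_iff]
  exact Iff.rfl

theorem mem_principalOpen {q : MvPolynomial (Fin n) K} {p : Fin n → K} :
    p ∈ principalOpen q ↔ eval p q ≠ 0 := Iff.rfl

theorem mem_zeroLocus_span_range {ι : Type*} {u : ι → MvPolynomial (Fin n) K} {p : Fin n → K} :
    p ∈ zeroLocus K (Ideal.span (Set.range u)) ↔ ∀ k, eval p (u k) = 0 := by
  rw [zeroLocus_span]
  simp

/-- If the radical of `I` is contained in `I` near every point of `D(q)`, then it is so on
`D(q)`. -/
theorem exists_pow_mul_mem [IsAlgClosed K] {I : Ideal (MvPolynomial (Fin n) K)}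
    {q a : MvPolynomial (Fin n) K}
    (h : ∀ p ∈ zeroLocus K I, eval p q ≠ 0 → ∃ s, eval p s ≠ 0 ∧ s * a ∈ I) :
    ∃ k : ℕ, q ^ k * a ∈ I := by
  -- The Nullstellensatz for the colon ideal `(I : a)`: by hypothesis it has no zeros in `D(q)`, so
  -- a power of `q` lies in it.
  have hq : q ∈ vanishingIdeal K (zeroLocus K (I.colon {a})) := by
    intro p hp
    by_contra hpq
    have hpI : p ∈ zeroLocus K I := fun f hf =>
      hp f (Submodule.mem_colon_singleton.2 (by simpa using I.mul_mem_right a hf))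
    rw [aeval_eq_eval] at hpq
    obtain ⟨s, hs, hsa⟩ := h p hpI hpq
    have := hp s (Submodule.mem_colon_singleton.2 (by simpa using hsa))
    rw [aeval_eq_eval] at this
    exact hs this
  rw [vanishingIdeal_zeroLocus_eq_radical] at hq
  obtain ⟨k, hk⟩ := hq
  exact ⟨k, by simpa using Submodule.mem_colon_singleton.1 hk⟩

section JacobianCriterion

variable [IsAlgClosed K] {c : ℕ} {u : Fin c → MvPolynomial (Fin n) K} {p : Fin n → K}

/-- The local ring of the scheme `V(u)` at a point where the gradients of `u` are linearly
independent is regular, also when it is formed in the quotient by a larger ideal that agrees with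
`⟨u⟩` near that point. -/
theorem isRegularLocalRing_of_linearIndependent {J : Ideal (MvPolynomial (Fin n) K)}
    (hIJ : Ideal.span (Set.range u) ≤ J)
    (P : Ideal (MvPolynomial (Fin n) K ⧸ J)) [P.IsPrime]
    (hP : P.comap (Ideal.Quotient.mk J) = vanishingIdeal K {p})
    (hJ : ∀ a ∈ J, ∃ s, eval p s ≠ 0 ∧ s * a ∈ Ideal.span (Set.range u))
    (hli : LinearIndependent K fun k => gradientAt p (u k)) :
    IsRegularLocalRing (Localization.AtPrime P) := by
  have hmem : ∀ a, a ∈ P.comap (Ideal.Quotient.mk J) ↔ eval p a = 0 := fun a => by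
    rw [hP, mem_vanishingIdeal_singleton]
  have hu : ∀ k, eval p (u k) = 0 := fun k => by
    rw [← hmem, Ideal.mem_comap,
      Ideal.Quotient.eq_zero_iff_mem.2 (hIJ (Ideal.subset_span ⟨k, rfl⟩))]
    exact P.zero_mem
  obtain ⟨m, hm, w, s, hw, hs, hsw⟩ := exists_local_generators p u hu hli
  let := ((algebraMap (MvPolynomial (Fin n) K ⧸ J) (Localization.AtPrime P)).comp
    (Ideal.Quotient.factor hIJ)).toAlgebra
  -- The local ring is also one of the quotient by `⟨u⟩`, where the bound `c` on the number of
  -- generators is available.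
  have hloc := IsLocalization.AtPrime.of_quotient_factor hIJ P
    (fun a ha => by simpa only [hmem] using hJ a ha) (Localization.AtPrime P)
  have hcomap : (P.comap (Ideal.Quotient.factor hIJ)).comap
      (Ideal.Quotient.mk (Ideal.span (Set.range u))) = P.comap (Ideal.Quotient.mk J) := by
    rw [Ideal.comap_comap]
    rfl
  refine IsRegularLocalRing.of_isLocalization_quotient (c := c) (m := m) ?_
    (P.comap (Ideal.Quotient.factor hIJ)) ?_ w ?_ (s := s) ?_ ?_ (Localization.AtPrime P)
  · refine (Submodule.spanFinrank_span_le_ncard_of_finite (Set.finite_range _)).trans ?_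
    rw [← Nat.card_coe_set_eq]
    exact (Finite.card_range_le _).trans_eq (Nat.card_fin c)
  · rw [hcomap, hP, height_vanishingIdeal_singleton, ← hm, Fintype.card_fin]
  · intro k
    rw [hcomap, hmem]
    exact hw k
  · rw [hcomap, hmem]
    exact hs
  · intro a ha
    rw [hcomap, hmem] at ha
    exact hsw a ha

/-- Near a point where the gradients of `u` are linearly independent, `⟨u⟩` is radical. -/
theorem exists_mul_mem_span_of_linearIndependent (hu : ∀ k, eval p (u k) = 0)
    (hli : LinearIndependent K fun k => gradientAt p (u k)) {a : MvPolynomial (Fin n) K}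
    (ha : a ∈ vanishingIdeal K (zeroLocus K (Ideal.span (Set.range u)))) :
    ∃ s, eval p s ≠ 0 ∧ s * a ∈ Ideal.span (Set.range u) := by
  set I := Ideal.span (Set.range u) with hI
  have hIM : I ≤ vanishingIdeal K {p} := by
    rw [hI, Ideal.span_le]
    rintro _ ⟨k, rfl⟩
    exact mem_vanishingIdeal_singleton.2 (hu k)
  let P := (vanishingIdeal K {p}).map (Ideal.Quotient.mk I)
  have hPp : P.IsPrime := Ideal.isPrime_map_quotientMk_of_isPrime hIM
  have hP : P.comap (Ideal.Quotient.mk I) = vanishingIdeal K {p} :=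
    Ideal.comap_map_mk hIM
  have hreg : IsRegularLocalRing (Localization.AtPrime P) :=
    isRegularLocalRing_of_linearIndependent le_rfl P hP
      (fun a ha => ⟨1, by simp, by simpa using ha⟩) hli
  -- A domain is reduced, so elements of the radical die in the local ring.
  have := IsRegularLocalRing.isDomain (Localization.AtPrime P)
  rw [vanishingIdeal_zeroLocus_eq_radical] at ha
  obtain ⟨s, hs, hsa⟩ := Ideal.exists_mul_mem_of_mem_radical P ha
  rw [hP, mem_vanishingIdeal_singleton] at hs
  exact ⟨s, hs, hsa⟩

/-- A closed point of `D(q)` keeps its height `n` under localization, and no prime of the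
localization has height above the dimension `n` of the polynomial ring. -/
theorem ringKrullDim_away {q : MvPolynomial (Fin n) K} (hq : eval p q ≠ 0) :
    ringKrullDim (Localization.Away q) = n ∧
      ((vanishingIdeal K {p}).map
        (algebraMap (MvPolynomial (Fin n) K) (Localization.Away q))).IsPrime ∧
      ((vanishingIdeal K {p}).map
        (algebraMap (MvPolynomial (Fin n) K) (Localization.Away q))).height = n := by
  have hdisj : Disjoint ((Submonoid.powers q : Submonoid _) : Set (MvPolynomial (Fin n) K))
      (vanishingIdeal K {p}) := by
    rw [Ideal.disjoint_powers_iff_notMem_of_isPrime, mem_vanishingIdeal_singleton]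
    exact hq
  have hprime := IsLocalization.isPrime_of_isPrime_disjoint (Submonoid.powers q)
    (Localization.Away q) _ (inferInstance : (vanishingIdeal K {p}).IsPrime) hdisj
  have hht : ((vanishingIdeal K {p}).map
      (algebraMap (MvPolynomial (Fin n) K) (Localization.Away q))).height = n := by
    rw [IsLocalization.height_map_of_disjoint (Submonoid.powers q) _ hdisj,
      height_vanishingIdeal_singleton, Fintype.card_fin]
  refine ⟨le_antisymm ?_ ?_, hprime, hht⟩
  · refine (ringKrullDim_le_iff_height_le _).2 fun Q hQ => ?_
    rw [← IsLocalization.height_under (Submonoid.powers q) Q]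
    refine (Ideal.height_le_ringKrullDim_of_ne_top Ideal.IsPrime.ne_top').trans ?_
    rw [MvPolynomial.ringKrullDim_of_isNoetherianRing, ringKrullDim_eq_zero_of_field, zero_add,
      Nat.card_fin]
  · have := Ideal.height_le_ringKrullDim_of_ne_top hprime.ne_top
    rw [hht] at this
    exact_mod_cast this

/-- The Jacobian criterion: if `V(u)` meets `D(q)`, and the gradients of the `c` polynomials `u`
are linearly independent at all points of `V(u) ∩ D(q)`, then `V(u) ∩ D(q)` is a smooth complete
intersection of codimension `c`. -/
theorem isSmoothCompleteIntersectionOn_of_linearIndependent {q : MvPolynomial (Fin n) K}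
    (hne : ∃ p, (∀ k, eval p (u k) = 0) ∧ eval p q ≠ 0)
    (hli : ∀ p, (∀ k, eval p (u k) = 0) → eval p q ≠ 0 →
      LinearIndependent K fun k => gradientAt p (u k)) :
    IsSmoothCompleteIntersectionOn (zeroLocus K (Ideal.span (Set.range u))) q c := by
  set Y := zeroLocus K (Ideal.span (Set.range u)) with hY
  have hmap : idealOn Y q = Ideal.span
      (Set.range fun k => algebraMap (MvPolynomial (Fin n) K) (Localization.Away q) (u k)) := by
    have hI : Ideal.span
      (Set.range fun k => algebraMap (MvPolynomial (Fin n) K) (Localization.Away q) (u k)) =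
        (Ideal.span (Set.range u)).map (algebraMap _ (Localization.Away q)) := by
      rw [Ideal.map_span, ← Set.range_comp]
      rfl
    rw [hI]
    refine le_antisymm (Ideal.map_le_iff_le_comap.2 fun a ha => ?_)
      (Ideal.map_mono (le_vanishingIdeal_zeroLocus _))
    obtain ⟨k, hk⟩ := exists_pow_mul_mem (q := q) (a := a) (fun p hp hpq =>
      exists_mul_mem_span_of_linearIndependent (mem_zeroLocus_span_range.1 hp)
        (hli p (mem_zeroLocus_span_range.1 hp) hpq) ha)
    have h := Ideal.mem_map_of_mem (algebraMap _ (Localization.Away q)) hk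
    rw [map_mul] at h
    exact (Ideal.unit_mul_mem_iff_mem _
      (IsLocalization.map_units (Localization.Away q) (⟨q ^ k, k, rfl⟩ : Submonoid.powers q))).1 h
  refine ⟨fun p hpq => ?_, ?_, _, hmap.symm⟩
  · have hp := mem_zeroLocus_span_range.1 p.2
    exact isRegularLocalRing_of_linearIndependent (le_vanishingIdeal_zeroLocus _) _
      (comap_pointIdeal Y p)
      (fun a ha => exists_mul_mem_span_of_linearIndependent hp (hli p hp hpq) ha) (hli p hp hpq)
  · obtain ⟨p₀, hp₀, hq₀⟩ := hne
    obtain ⟨hdim, hprime, hht⟩ := ringKrullDim_away hq₀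
    have hc : c ≤ n := by
      simpa using (hli p₀ hp₀ hq₀).fintype_card_le_finrank
    obtain ⟨m, rfl⟩ := Nat.exists_eq_add_of_le' hc
    have hrank : (idealOn Y q).spanFinrank ≤ c := by
      rw [hmap]
      refine (Submodule.spanFinrank_span_le_ncard_of_finite (Set.finite_range _)).trans ?_
      rw [← Nat.card_coe_set_eq]
      exact (Finite.card_range_le _).trans_eq (Nat.card_fin c)
    -- The point `p₀` has height `n` in `D(q)`, and `c` equations lower the dimension there by at
    -- most `c`. This is where non-emptiness enters.
    have hlow : ringKrullDim (Localization.Away q) ≤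
        ringKrullDim (Localization.Away q ⧸ idealOn Y q) + (c : WithBot ℕ∞) := by
      have h := height_le_ringKrullDim_quotient_add_spanFinrank (I := idealOn Y q)
        (p := (vanishingIdeal K {p₀}).map (algebraMap _ (Localization.Away q)))
        (Ideal.map_mono (vanishingIdeal_anti_mono
          (Set.singleton_subset_iff.2 (mem_zeroLocus_span_range.2 hp₀))))
      rw [hht] at h
      rw [hdim]
      refine le_trans (by exact_mod_cast h) (add_le_add_right (by exact_mod_cast hrank) _)
    refine le_antisymm hlow ?_
    -- By the Nullstellensatz a maximal ideal of the quotient is a point of `V(u) ∩ D(q)`; near it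
    -- the `m = n - c` complementary polynomials generate, which bounds its height.
    have hup : ringKrullDim (Localization.Away q ⧸ idealOn Y q) ≤ (m : WithBot ℕ∞) := by
      refine (ringKrullDim_le_iff_isMaximal_height_le _).2 fun N hN => ?_
      let φ := (Ideal.Quotient.mk (idealOn Y q)).comp
        (algebraMap (MvPolynomial (Fin (m + c)) K) (Localization.Away q))
      let N' := N.comap (Ideal.Quotient.mk (idealOn Y q))
      have hN' : N'.IsMaximal :=
        Ideal.comap_isMaximal_of_surjective _ Ideal.Quotient.mk_surjective
      obtain ⟨hmax, hqN⟩ := (IsLocalization.isMaximal_iff_isMaximal_disjoint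
        (Localization.Away q) q N').1 hN'
      obtain ⟨p, hp⟩ := isMaximal_iff_eq_vanishingIdeal_singleton.1 hmax
      have hcomap : N.comap φ = vanishingIdeal K {p} := by
        rw [← hp, Ideal.under_def, Ideal.comap_comap]
      rw [hp, mem_vanishingIdeal_singleton] at hqN
      have hφu : ∀ k, φ (u k) = 0 := fun k => by
        refine Ideal.Quotient.eq_zero_iff_mem.2 ?_
        rw [hmap]
        exact Ideal.subset_span ⟨k, rfl⟩
      have hpu : ∀ k, eval p (u k) = 0 := fun k => by
        rw [← mem_vanishingIdeal_singleton, ← hcomap, Ideal.mem_comap, hφu]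
        exact N.zero_mem
      obtain ⟨m', hm', w, s, hw, hs, hsw⟩ := exists_local_generators p u hpu (hli p hpu hqN)
      obtain rfl : m' = m := by simpa using hm'
      have hht := Ideal.height_le_of_forall_mul_mem_span φ N ?_ w
        (fun k => by rw [hcomap, mem_vanishingIdeal_singleton]; exact hw k) (s := s)
        (by rwa [hcomap, mem_vanishingIdeal_singleton]) ?_
      · exact_mod_cast hht
      · rw [← Ideal.map_map, ← Ideal.comap_comap]
        have h1 : (N'.under (MvPolynomial (Fin (m' + c)) K)).map
            (algebraMap _ (Localization.Away q)) = N' :=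
          IsLocalization.map_under (Submonoid.powers q) _ N'
        rw [Ideal.under_def] at h1
        rw [h1, Ideal.map_comap_of_surjective _ Ideal.Quotient.mk_surjective]
      · intro a ha
        rw [hcomap, mem_vanishingIdeal_singleton] at ha
        have h := Ideal.mem_map_of_mem φ (hsw a ha)
        rw [Ideal.map_sup, Ideal.map_span, Ideal.map_span, ← Set.range_comp, ← Set.range_comp] at h
        have h0 : Ideal.span (Set.range (φ ∘ u)) = ⊥ := by
          rw [Ideal.span_eq_bot]
          rintro _ ⟨k, rfl⟩
          exact hφu k
        rwa [h0, bot_sup_eq] at h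
    rw [hdim]
    refine (add_le_add_left hup _).trans_eq (by push_cast; rfl)

end JacobianCriterion

end MaxContact

/-! ### Row operations on the Jacobian matrix and relative derivatives. -/

namespace MaxContact

variable {K : Type*} [Field K] {n r : ℕ} {F : Fin r → MvPolynomial (Fin n) K} {e : Fin r ↪ Fin n}
  {p : Fin n → K}

/-- The derivatives of the cofactors do not contribute, since they are multiplied by values of `F`
at `p`. -/
theorem gradientAt_tildeSystem (hF : ∀ k, eval p (F k) = 0) (k : Fin r) :
    gradientAt p (tildeSystem F e k) =
      ∑ l, eval p ((jacobianSubmatrix F e).adjugate k l) • gradientAt p (F l) := by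
  simp [tildeSystem, Matrix.mulVec, dotProduct, gradientAt_mul, hF]

/-- This is the identity `A · M = h · Eᵣ` evaluated at `p`. -/
theorem gradientAt_tildeSystem_apply (hF : ∀ k, eval p (F k) = 0) (k l : Fin r) :
    gradientAt p (tildeSystem F e k) (e l) =
      eval p (jacobianMinor F e) * (1 : Matrix (Fin r) (Fin r) K) k l := by
  have h := congrArg (eval p) (congrFun (congrFun (Matrix.adjugate_mul (jacobianSubmatrix F e)) k) l)
  rw [Matrix.mul_apply, map_sum] at h
  rw [gradientAt_tildeSystem hF, Finset.sum_apply]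
  refine Eq.trans (Finset.sum_congr rfl fun m _ => ?_) (h.trans ?_)
  · rw [map_mul]
    rfl
  · by_cases hkl : k = l
    · subst hkl; simp [jacobianMinor]
    · simp [hkl]

theorem tildeSystem_mem_span (k : Fin r) : tildeSystem F e k ∈ Ideal.span (Set.range F) := by
  rw [tildeSystem, Matrix.mulVec, dotProduct]
  exact Ideal.sum_mem _ fun l _ => Ideal.mul_mem_left _ _ (Ideal.subset_span ⟨l, rfl⟩)

theorem eval_tildeSystem (hF : ∀ k, eval p (F k) = 0) (k : Fin r) :
    eval p (tildeSystem F e k) = 0 := by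
  simp [tildeSystem, Matrix.mulVec, dotProduct, hF]

theorem gradientAt_tildePoly (hF : ∀ k, eval p (F k) = 0) {f : MvPolynomial (Fin n) K}
    (hf : eval p f = 0) :
    gradientAt p (tildePoly F e f) = eval p (jacobianMinor F e) • gradientAt p f -
      ∑ k, eval p (pderiv (e k) f) • gradientAt p (tildeSystem F e k) := by
  simp [tildePoly, gradientAt_mul, hf, eval_tildeSystem hF]

/-- In column `e l` only the correction term with `k = l` survives, and it cancels `h ∂f/∂x_{e l}`
exactly. -/
theorem gradientAt_tildePoly_apply (hF : ∀ k, eval p (F k) = 0) {f : MvPolynomial (Fin n) K}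
    (hf : eval p f = 0) (l : Fin r) : gradientAt p (tildePoly F e f) (e l) = 0 := by
  rw [gradientAt_tildePoly hF hf, Pi.sub_apply, Finset.sum_apply]
  simp only [Pi.smul_apply, smul_eq_mul, gradientAt_tildeSystem_apply hF, Matrix.one_apply]
  simp [gradientAt_apply, mul_comm]

/-- The hypothesis says that the row vector `a` is killed by `M(p)`, which is invertible because its
determinant is `h(p)`. -/
theorem eq_zero_of_sum_gradientAt_eq_zero (hh : eval p (jacobianMinor F e) ≠ 0) {a : Fin r → K}
    (ha : ∀ l, (∑ k, a k • gradientAt p (F k)) (e l) = 0) : a = 0 := by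
  refine Matrix.eq_zero_of_vecMul_eq_zero
    (M := (jacobianSubmatrix F e).map (eval p)) ?_ ?_
  · rwa [jacobianMinor, RingHom.map_det] at hh
  · ext l
    have := ha l
    rw [Finset.sum_apply] at this
    exact this

/-- If the minor `h` and the partial derivative `∂f̃/∂x_j` do not vanish at a common zero of `F`
and `f`, then the gradients of `F` and `f` are linearly independent there. -/
theorem linearIndependent_gradientAt_snoc (hF : ∀ k, eval p (F k) = 0)
    {f : MvPolynomial (Fin n) K} (hf : eval p f = 0) (hh : eval p (jacobianMinor F e) ≠ 0)
    {j : Fin n} (hj : eval p (pderiv j (tildePoly F e f)) ≠ 0) :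
    LinearIndependent K fun k =>
      gradientAt p ((Fin.snoc F f : Fin (r + 1) → MvPolynomial (Fin n) K) k) := by
  have hsnoc : (fun k => gradientAt p ((Fin.snoc F f : Fin (r + 1) → MvPolynomial (Fin n) K) k)) =
      Fin.snoc (fun k => gradientAt p (F k)) (gradientAt p f) := by
    ext1 k
    refine Fin.lastCases ?_ (fun k => ?_) k <;> simp
  rw [hsnoc, linearIndependent_finSnoc]
  constructor
  · rw [Fintype.linearIndependent_iff]
    intro a ha
    refine congrFun (eq_zero_of_sum_gradientAt_eq_zero hh fun l => ?_)
    rw [ha]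
    rfl
  · intro hspan
    set S := Submodule.span K (Set.range fun k => gradientAt p (F k))
    have hT : gradientAt p (tildePoly F e f) ∈ S := by
      rw [gradientAt_tildePoly hF hf]
      refine sub_mem (S.smul_mem _ hspan) (sum_mem fun k _ => S.smul_mem _ ?_)
      rw [gradientAt_tildeSystem hF]
      exact sum_mem fun l _ => S.smul_mem _ (Submodule.subset_span ⟨l, rfl⟩)
    -- The gradient of `f̃` is a combination of the gradients of `F` that vanishes in the columns
    -- `e`, so all its coefficients are 0.
    obtain ⟨b, hb⟩ := (Submodule.mem_span_range_iff_exists_fun K).1 hT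
    have hb0 := eq_zero_of_sum_gradientAt_eq_zero hh (a := b) fun l => by
      rw [hb, gradientAt_tildePoly_apply hF hf]
    apply hj
    rw [← gradientAt_apply, ← hb, hb0]
    simp

/-- At a zero of `f` in `W ∩ D(h)`, relative derivatives have the value of `∂f̃/∂x_j`. -/
theorem IsRelativeDerivative.eval_eq {W : Set (Fin n → K)} {f g : MvPolynomial (Fin n) K}
    {j : Fin n} (hg : IsRelativeDerivative F e W f j g) (hp : p ∈ W) (hf : eval p f = 0)
    (hh : eval p (jacobianMinor F e) ≠ 0) :
    eval p g = eval p (pderiv j (tildePoly F e f)) := by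
  have hev : ∀ a, evalAt W ⟨p, hp⟩ (toCoordRing W a) = eval p a := fun a => by
    rw [← aeval_eq_eval]
    rfl
  have hunit : IsUnit ((evalAt W ⟨p, hp⟩ : CoordRing W →+* K)
      (toCoordRing W (jacobianMinor F e))) := by
    rw [RingHom.coe_coe, hev]
    exact hh.isUnit
  -- Evaluation at `p` extends to `𝒪_W(W ∩ D(h))` because `h(p) ≠ 0`, and it kills `⟨f⟩` because
  -- `f(p) = 0`.
  let ψ : SectionsOn W (jacobianMinor F e) →+* K := IsLocalization.Away.lift _ hunit
  have hψ : ∀ a, ψ (algebraMap _ _ (toCoordRing W a)) = eval p a := fun a => by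
    rw [← hev a]
    exact IsLocalization.Away.lift_eq _ hunit _
  obtain ⟨b, hb⟩ := Ideal.mem_span_singleton'.1 hg
  have := congrArg ψ hb
  rw [map_mul, hψ, hψ, hf, mul_zero, map_sub] at this
  exact (sub_eq_zero.1 this.symm)

/-- If `f` and all partial derivatives of `f̃` vanish at a point of `W ∩ D(h)`, then `f` has order at
least two there as a function on `W`. -/
theorem mem_maximalIdeal_sq {W : Set (Fin n → K)}
    (hFW : Ideal.span (Set.range F) = vanishingIdeal K W) (hp : p ∈ W)
    {f : MvPolynomial (Fin n) K} (hf : eval p f = 0) (hh : eval p (jacobianMinor F e) ≠ 0)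
    (hgrad : gradientAt p (tildePoly F e f) = 0) :
    algebraMap (CoordRing W) (LocalRingAt W ⟨p, hp⟩) (toCoordRing W f) ∈
      IsLocalRing.maximalIdeal (LocalRingAt W ⟨p, hp⟩) ^ 2 := by
  have hF : ∀ k, eval p (F k) = 0 := fun k => by
    have : F k ∈ vanishingIdeal K W := hFW ▸ Ideal.subset_span ⟨k, rfl⟩
    simpa using this p hp
  have htilde : eval p (tildePoly F e f) = 0 := by
    simp [tildePoly, hf, eval_tildeSystem hF]
  have hsq := sub_sub_linearFormAt_mem p (tildePoly F e f)
  rw [hgrad, htilde, map_zero, map_zero, sub_zero, sub_zero] at hsq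
  let φ := (algebraMap (CoordRing W) (LocalRingAt W ⟨p, hp⟩)).comp (toCoordRing W)
  have hφM : (vanishingIdeal K {p}).map φ ≤ IsLocalRing.maximalIdeal _ := by
    rw [← Ideal.map_map, ← Localization.AtPrime.map_eq_maximalIdeal]
    refine Ideal.map_mono (Ideal.map_le_iff_le_comap.2 ?_)
    exact (comap_pointIdeal W ⟨p, hp⟩).ge
  have h1 : φ (tildePoly F e f) ∈ IsLocalRing.maximalIdeal (LocalRingAt W ⟨p, hp⟩) ^ 2 := by
    have := Ideal.mem_map_of_mem φ hsq
    rw [Ideal.map_pow] at this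
    exact Ideal.pow_right_mono hφM 2 this
  -- On `W` the corrections vanish, so `f̃` is `h f`; as `h` is a unit at `p`, membership in `𝔪²`
  -- passes from `f̃` to `f`.
  have h2 : φ (tildePoly F e f) = φ (jacobianMinor F e) * φ f := by
    have : φ (jacobianMinor F e * f - tildePoly F e f) = 0 := by
      have hmem : jacobianMinor F e * f - tildePoly F e f ∈ vanishingIdeal K W := by
        rw [tildePoly, sub_sub_cancel, ← hFW]
        exact Ideal.sum_mem _ fun k _ => Ideal.mul_mem_left _ _ (tildeSystem_mem_span k)
      have h0 : toCoordRing W (jacobianMinor F e * f - tildePoly F e f) = 0 :=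
        Ideal.Quotient.eq_zero_iff_mem.2 hmem
      rw [RingHom.comp_apply, h0, map_zero]
    rw [map_sub, map_mul, sub_eq_zero] at this
    exact this.symm
  have hunit : IsUnit (φ (jacobianMinor F e)) :=
    IsLocalization.map_units (LocalRingAt W ⟨p, hp⟩)
      (⟨toCoordRing W (jacobianMinor F e), fun h => hh (by
        have : jacobianMinor F e ∈ vanishingIdeal K {p} := by
          rw [← comap_pointIdeal W ⟨p, hp⟩]
          exact h
        exact mem_vanishingIdeal_singleton.1 this)⟩ : (pointIdeal W ⟨p, hp⟩).primeCompl)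
  rw [h2] at h1
  exact (Ideal.unit_mul_mem_iff_mem _ hunit).1 h1

/-- A point of `X ∩ D(h)` outside `Sing(I_{X,W}, 2)` lies in `D(∂f_i/∂x_j)` for one of the
generators `f_i` of `I_{X,W}`. -/
theorem exists_pderiv_tildePoly_ne_zero {t : ℕ} {X W : Set (Fin n → K)}
    (hFW : Ideal.span (Set.range F) = vanishingIdeal K W) {f : Fin t → MvPolynomial (Fin n) K}
    (hf : Ideal.span (Set.range fun i => toCoordRing W (f i)) = relVanishingIdeal X W)
    (hpX : p ∈ X) (hpW : p ∈ W) (hfp : ∀ i, eval p (f i) = 0)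
    (hh : eval p (jacobianMinor F e) ≠ 0) (hp : p ∉ orderLocus X W 2) :
    ∃ i, ∃ j ∉ Set.range e, eval p (pderiv j (tildePoly F e (f i))) ≠ 0 := by
  by_contra! hcon
  have hF : ∀ k, eval p (F k) = 0 := fun k => by
    have : F k ∈ vanishingIdeal K W := hFW ▸ Ideal.subset_span ⟨k, rfl⟩
    simpa using this p hpW
  refine hp ⟨hpX, hpW, ?_⟩
  refine le_iSup₂_of_le (f := fun (k : ℕ) _ => (k : ℕ∞)) 2 ?_ le_rfl
  rw [← hf, Ideal.map_span, Ideal.span_le]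
  rintro _ ⟨_, ⟨i, rfl⟩, rfl⟩
  refine mem_maximalIdeal_sq hFW hpW (hfp i) hh ?_
  ext j
  by_cases hj : j ∈ Set.range e
  · obtain ⟨l, rfl⟩ := hj
    exact gradientAt_tildePoly_apply hF (hfp i) l
  · exact hcon i j hj

end MaxContact

/-! ### Assembling the finite cover. -/

theorem mainTheorem1 {K : Type*} [Field K] [IsAlgClosed K] {n r t : ℕ}
    (X W : Set (Fin n → K))
    (hX : MaxContact.IsAffineVariety X) (hW : MaxContact.IsAffineVariety W) (hXW : X ⊆ W)
    -- `W` is a smooth complete intersection of codimension `r`, with `I_W = ⟨F₁, …, Fᵣ⟩`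
    (hWci : MaxContact.IsSmoothCompleteIntersectionOn W 1 r)
    (F : Fin r → MvPolynomial (Fin n) K)
    (hF : Ideal.span (Set.range F) = MvPolynomial.vanishingIdeal K W)
    -- `f₁, …, f_t` represent generators of `I_{X,W}`
    (f : Fin t → MvPolynomial (Fin n) K)
    (hf : Ideal.span (Set.range fun i => MaxContact.toCoordRing W (f i)) =
      MaxContact.relVanishingIdeal X W)
    -- `h` is the maximal minor of the Jacobian matrix of `F` with columns `e`
    (e : Fin r ↪ Fin n) (h : MvPolynomial (Fin n) K) (hh : h = MaxContact.jacobianMinor F e)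
    -- `H i j` is a polynomial representing the relative derivative `∂f_i/∂X_j`
    (H : Fin t → {j : Fin n // j ∉ Set.range e} → MvPolynomial (Fin n) K)
    (hH : ∀ i j, MaxContact.IsRelativeDerivative F e W (f i) j.1 (H i j))
    (hSing : MaxContact.orderLocus X W 2 ∩ MaxContact.principalOpen h = ∅) :
    ∃ S : Finset (Fin t × {j : Fin n // j ∉ Set.range e}),
      (X ∩ MaxContact.principalOpen h ⊆ ⋃ ij ∈ S, MaxContact.principalOpen (h * H ij.1 ij.2)) ∧
      ∀ ij ∈ S, ∀ W' : Set (Fin n → K),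
        W' = MvPolynomial.zeroLocus K (Ideal.span (Set.range F ∪ {f ij.1})) →
        MaxContact.IsSmoothCompleteIntersectionOn W' (h * H ij.1 ij.2) (r + 1) ∧
        X ∩ MaxContact.principalOpen (h * H ij.1 ij.2) ⊆
          W' ∩ MaxContact.principalOpen (h * H ij.1 ij.2) := by
  classical
  subst hh
  have hfX : ∀ i, ∀ p ∈ X, eval p (f i) = 0 := by
    intro i p hp
    have h1 : MaxContact.toCoordRing W (f i) ∈ MaxContact.relVanishingIdeal X W :=
      hf ▸ Ideal.subset_span ⟨i, rfl⟩
    have h2 : MaxContact.relVanishingIdeal X W ≤ MaxContact.pointIdeal W ⟨p, hXW hp⟩ := by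
      refine Ideal.map_le_iff_le_comap.2 ?_
      refine le_trans ?_ (MaxContact.comap_pointIdeal W ⟨p, hXW hp⟩).ge
      exact vanishingIdeal_anti_mono (Set.singleton_subset_iff.2 hp)
    have h3 : f i ∈ vanishingIdeal K {p} := by
      rw [← MaxContact.comap_pointIdeal W ⟨p, hXW hp⟩]
      exact h2 h1
    exact mem_vanishingIdeal_singleton.1 h3
  have hWF : ∀ p, p ∈ W ↔ ∀ k, eval p (F k) = 0 := by
    intro p
    obtain ⟨I, rfl⟩ := hW
    rw [← MaxContact.mem_zeroLocus_span_range, hF]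
    exact ⟨fun hp => zeroLocus_vanishingIdeal_le _ hp,
      fun hp => zeroLocus_anti_mono (le_vanishingIdeal_zeroLocus I) hp⟩
  -- There are only finitely many pairs `(i, j)`. Those whose open set misses `X` are not needed for
  -- the cover and are dropped: for them `W' ∩ D(hg)` might be empty, and the codimension could
  -- fail.
  refine ⟨Finset.univ.filter fun ij =>
    (X ∩ MaxContact.principalOpen (MaxContact.jacobianMinor F e * H ij.1 ij.2)).Nonempty, ?_, ?_⟩
  · rintro p ⟨hpX, hph⟩
    obtain ⟨i, j, hj, hne⟩ := MaxContact.exists_pderiv_tildePoly_ne_zero hF hf hpX (hXW hpX)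
      (fun i => hfX i p hpX) hph (fun hp => Set.eq_empty_iff_forall_notMem.1 hSing p ⟨hp, hph⟩)
    have hmem : p ∈ MaxContact.principalOpen (MaxContact.jacobianMinor F e * H i ⟨j, hj⟩) := by
      rw [MaxContact.mem_principalOpen, map_mul,
        (hH i ⟨j, hj⟩).eval_eq (hXW hpX) (hfX i p hpX) hph]
      exact mul_ne_zero hph hne
    refine Set.mem_iUnion₂.2 ⟨(i, ⟨j, hj⟩), ?_, hmem⟩
    rw [Finset.mem_filter]
    exact ⟨Finset.mem_univ _, p, hpX, hmem⟩
  · rintro ⟨i, j⟩ hij W' rfl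
    obtain ⟨-, p₀, hp₀X, hp₀⟩ := Finset.mem_filter.1 hij
    dsimp only at hp₀ ⊢
    have hrange : Set.range F ∪ {f i} =
        Set.range (Fin.snoc F (f i) : Fin (r + 1) → MvPolynomial (Fin n) K) := by
      rw [Fin.range_snoc, Set.union_singleton]
    have hsnoc : ∀ p, (∀ k, eval p ((Fin.snoc F (f i) :
        Fin (r + 1) → MvPolynomial (Fin n) K) k) = 0) ↔ p ∈ W ∧ eval p (f i) = 0 := by
      intro p
      simp [Fin.forall_fin_succ', hWF]
    rw [hrange]
    refine ⟨MaxContact.isSmoothCompleteIntersectionOn_of_linearIndependent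
      (u := Fin.snoc F (f i)) (q := MaxContact.jacobianMinor F e * H i j) ⟨p₀, (hsnoc p₀).2 ⟨hXW hp₀X, hfX i p₀ hp₀X⟩,
      MaxContact.mem_principalOpen.1 hp₀⟩ fun p hp hpq => ?_, ?_⟩
    · obtain ⟨hpW, hpf⟩ := (hsnoc p).1 hp
      rw [map_mul] at hpq
      refine MaxContact.linearIndependent_gradientAt_snoc ((hWF p).1 hpW) hpf
        (left_ne_zero_of_mul hpq) (j := j) ?_
      rw [← (hH i j).eval_eq hpW hpf (left_ne_zero_of_mul hpq)]
      exact right_ne_zero_of_mul hpq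
    · rintro p ⟨hpX, hpq⟩
      exact ⟨MaxContact.mem_zeroLocus_span_range.2 ((hsnoc p).2 ⟨hXW hpX, hfX i p hpX⟩), hpq⟩
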